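/- **Setting.** Let $\rho$ be a measure on $\mathbb{R}$, $h\ge 0$ measurable, and consider the natural exponential family of densities (with respect to $\rho$) $$p(x,\theta)=h(x)\exp\left(x\theta-A(\theta)\right),\quad \theta\in\Theta=\Big\{\theta\in\mathbb{R}:\int h(x)e^{x\theta}\,\rho(dx)<\infty\Big\},\quad A(\theta)=\log\int h(x)e^{x\theta}\,\rho(dx),$$ whose laws are assumed non-degenerate (not concentrated at one point) and with finite mean for every $\theta\in\Theta$. Let $D(\theta,\theta')$ be the Kullback–Leibler divergence between the laws with parameters $\theta$ and $\theta'$. In a two-armed bandit environment $\nu=(\theta_1,\theta_2)\in\Theta^2$, a play of arm $k$ yields an independent reward with density $p(\cdot,\theta_k)$. An algorithm $\pi$ (not depending on $\nu$ or on the horizon) chooses each arm, possibly with randomization, on the basis of the arms played and the rewards received so far; $\mathbb{P}_{\nu\pi}$ is the resulting law and $N_k(T)$ is the number of plays of arm $k$ among the first $T$ plays. Consider the following conditions. (A1) For every environment $\nu=(\theta_1,\theta_2)$ with a sub-optimal arm $k$ and better arm $j$, i.e. $\theta_k<\theta_j$, $\{j,k\}=\{1,2\}$, $$\lim_{T\to\infty}\frac{\mathbb{E}_{\nu\pi}[N_k(T)]}{\log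 T}=\frac{1}{D(\theta_k,\theta_j)}.$$ (A2) $\inf\Theta=-\infty$ and $\lim_{\theta\to-\infty}\big(\theta A'(\theta)-A(\theta)\big)=\infty$. **Theorem.** Suppose (A1) holds. Then for every environment $\nu=(\theta_1,\theta_2)$ with $\theta_1>\theta_2$ (arm 2 is sub-optimal) and every $\gamma\in(0,1)$, $$\liminf_{T\to\infty}\ \inf_{x\in[T^\gamma,(1-\gamma)T]}\frac{\log\mathbb{P}_{\nu\pi}(N_2(T)\ge x)}{\log x}\ \ge\ -\inf_{\widetilde\theta_1\in\Theta:\ \widetilde\theta_1<\theta_2}\frac{D(\widetilde\theta_1,\theta_1)}{D(\widetilde\theta_1,\theta_2)}$$ (with $\log 0=-\infty$ and $\inf\emptyset=+\infty$). If in addition (A2) holds, then $$\lim_{T\to\infty}\frac{\log\mathbb{P}_{\nu\pi}(N_2(T)\ge x)}{\log x}=-1$$ uniformly for $x\in[T^\gamma,(1-\gamma)T]$. The same holds with the two arms interchanged. -/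

import Mathlib

open MeasureTheory ProbabilityTheory Filter Topology Set

noncomputable section

/-- A natural one-parameter exponential family of non-degenerate laws on `ℝ`: its densities with
respect to the dominating measure `ρ` are `h x * exp (x * θ - A θ)`, where `θ` ranges over all reals
for which `h x * exp (x * θ)` is `ρ`-integrable. -/
structure ExpFamily where
  /-- the dominating measure -/
  ρ : Measure ℝ
  /-- the carrier function -/
  h : ℝ → ℝ
  measurable_h : Measurable h
  h_nonneg : ∀ x, 0 ≤ h x
  /-- The laws are not concentrated on one point (in particular `h` does not vanish a.e.). -/
  nondegenerate : ∀ c : ℝ, ¬ ∀ᵐ x ∂ρ, h x ≠ 0 → x = c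
  /-- All laws of the family have a finite mean. -/
  finite_mean : ∀ θ : ℝ, Integrable (fun x => h x * Real.exp (x * θ)) ρ →
    Integrable (fun x => x * (h x * Real.exp (x * θ))) ρ

namespace ExpFamily

/-- The natural parameter space `Θ`. -/
def Θ (F : ExpFamily) : Set ℝ :=
  {θ | Integrable (fun x => F.h x * Real.exp (x * θ)) F.ρ}

/-- The log-partition function `A`. -/
def A (F : ExpFamily) (θ : ℝ) : ℝ :=
  Real.log (∫ x, F.h x * Real.exp (x * θ) ∂F.ρ)

/-- The density `p(x, θ)`. -/
def density (F : ExpFamily) (θ x : ℝ) : ℝ :=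
  F.h x * Real.exp (x * θ - F.A θ)

/-- The law on `ℝ` with density `p(·, θ)` with respect to `ρ`. -/
def law (F : ExpFamily) (θ : ℝ) : Measure ℝ :=
  F.ρ.withDensity fun x => ENNReal.ofReal (F.density θ x)

theorem integral_pos (F : ExpFamily) {θ : ℝ} (hθ : θ ∈ F.Θ) :
    0 < ∫ x, F.h x * Real.exp (x * θ) ∂F.ρ := by
  have hnn : 0 ≤ fun x => F.h x * Real.exp (x * θ) := fun x =>
    mul_nonneg (F.h_nonneg x) (Real.exp_pos _).le
  refine lt_of_le_of_ne (integral_nonneg hnn) fun h0 => ?_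
  have h1 := (integral_eq_zero_iff_of_nonneg hnn hθ).1 h0.symm
  refine F.nondegenerate 0 ?_
  filter_upwards [h1] with x hx hx'
  exact absurd hx (mul_ne_zero hx' (Real.exp_pos _).ne')

instance isProbabilityMeasure_law (F : ExpFamily) (θ : F.Θ) :
    IsProbabilityMeasure (F.law θ) := by
  have hpos := F.integral_pos θ.2
  have hint : Integrable (fun x => F.h x * Real.exp (x * θ)) F.ρ := θ.2
  have hd : F.density θ =
      fun x => (F.h x * Real.exp (x * θ)) * Real.exp (-F.A θ) := by
    funext x
    rw [density, sub_eq_add_neg, Real.exp_add, mul_assoc]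
  constructor
  rw [law, withDensity_apply _ MeasurableSet.univ, Measure.restrict_univ,
    ← ofReal_integral_eq_lintegral_ofReal, hd, integral_mul_const, A, Real.exp_neg,
    Real.exp_log hpos, mul_inv_cancel₀ hpos.ne', ENNReal.ofReal_one]
  · rw [hd]
    exact hint.mul_const _
  · exact ae_of_all _ fun x => mul_nonneg (F.h_nonneg x) (Real.exp_pos _).le

/-- The Kullback-Leibler divergence `D(θ, θ')` between the laws with parameters `θ` and `θ'`. -/
def D (F : ExpFamily) (θ θ' : ℝ) : ℝ :=
  (InformationTheory.klDiv (F.law θ) (F.law θ')).toReal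

/-- `inf Θ = -∞` and `θ A'(θ) - A(θ) → ∞` as `θ → -∞`. -/
def LeftTailCondition (F : ExpFamily) : Prop :=
  ¬ BddBelow F.Θ ∧ Tendsto (fun θ : ℝ => θ * deriv F.A θ - F.A θ) atBot atTop

end ExpFamily

/-- The history of the plays `0, …, n`: for each of them the arm played and the reward received. -/
abbrev History (n : ℕ) : Type := (i : Finset.Iic n) → Fin 2 × ℝ

/-- A (randomized) algorithm for the two-armed bandit: the law of the first arm played, and
the conditional law of the next arm to play given the arms played and rewards received so far. -/
structure BanditAlgorithm where
  first : Measure (Fin 2)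
  next : (n : ℕ) → Kernel (History n) (Fin 2)
  isProbabilityMeasure_first : IsProbabilityMeasure first
  isMarkovKernel_next : ∀ n, IsMarkovKernel (next n)

attribute [instance] BanditAlgorithm.isProbabilityMeasure_first
  BanditAlgorithm.isMarkovKernel_next

/-- The kernel that draws a reward of the arm it is given, in the environment `ν`. -/
def rewardKernel (ν : Fin 2 → Measure ℝ) : Kernel (Fin 2) ℝ where
  toFun := ν
  measurable' := measurable_of_finite ν

instance isMarkovKernel_rewardKernel (ν : Fin 2 → Measure ℝ) [∀ k, IsProbabilityMeasure (ν k)] :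
    IsMarkovKernel (rewardKernel ν) :=
  ⟨fun k => inferInstanceAs (IsProbabilityMeasure (ν k))⟩

namespace BanditAlgorithm

/-- The law `ℙ_{νπ}` of the sequence of (arm played, reward received) when the algorithm `π`
interacts with the environment `ν`. -/
def interaction (π : BanditAlgorithm) (ν : Fin 2 → Measure ℝ) [∀ k, IsProbabilityMeasure (ν k)] :
    Measure (ℕ → Fin 2 × ℝ) :=
  Kernel.trajMeasure (X := fun _ => Fin 2 × ℝ) (π.first ⊗ₘ rewardKernel ν)
    fun n => π.next n ⊗ₖ Kernel.prodMkLeft (History n) (rewardKernel ν)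

end BanditAlgorithm

/-- The number `N_k(T)` of plays of arm `k` among the first `T` plays. -/
def numPlays (k : Fin 2) (T : ℕ) (ω : ℕ → Fin 2 × ℝ) : ℕ :=
  ((Finset.range T).filter fun t => (ω t).1 = k).card

namespace ExpFamily

/-- `ℙ_{νπ}` for the environment whose arm `k` has the law with parameter `ν k`. -/
def banditLaw (F : ExpFamily) (π : BanditAlgorithm) (ν : Fin 2 → F.Θ) :
    Measure (ℕ → Fin 2 × ℝ) :=
  π.interaction fun k => F.law (ν k)

/-- The algorithm `π` is optimized over the family `F`: in every environment with a sub-optimal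
arm `k` and a better arm `j`, the expected number of plays of arm `k` attains the Lai-Robbins
rate. -/
def IsOptimized (F : ExpFamily) (π : BanditAlgorithm) : Prop :=
  ∀ (ν : Fin 2 → F.Θ) (j k : Fin 2), ν k < ν j →
    Tendsto (fun T : ℕ => (∫ ω, (numPlays k T ω : ℝ) ∂(F.banditLaw π ν)) / Real.log T) atTop
      (𝓝 (1 / F.D (ν k) (ν j)))

end ExpFamily

end

/-! The lower bound comes from a change of environment. Lower the parameter of the better arm `j` to
some θ below `ν k`. Arm `k` is now the better one, so arm `j` is played only about log T / D(θ, ν k)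
times, and N_k ≥ x becomes almost certain. The two laws of the history differ only through the
rewards of arm `j`, so their divergence is at most E[N_j(T)] D(θ, ν j), about log T times D(θ, ν j)
/ D(θ, ν k) (`klDiv_interaction_le`). An event almost certain under one law has log-probability at
least about minus the divergence under the other (`log_measureReal_ge_of_klDiv_le`). To obtain log x
in place of log T, this is done at the horizon ⌊x / (1 - γ)⌋; monotonicity of N_k in T then covers
every longer horizon.

Markov's inequality bounds the exponent above by -1. Under the left tail condition the ratio of
divergences can be brought arbitrarily close to 1 (`exists_D_div_D_le`), so the two bounds meet. -/

noncomputable section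
-- Kullback–Leibler divergence: restriction, change of measure, kernels
open InformationTheory in
theorem klDiv_withDensity_eq_lintegral {α : Type*} [MeasurableSpace α] (ν : Measure α)
    [IsFiniteMeasure ν] {f : α → ENNReal} (hf : Measurable f)
    [IsFiniteMeasure (ν.withDensity f)] :
    klDiv (ν.withDensity f) ν = ∫⁻ x, ENNReal.ofReal (klFun (f x).toReal) ∂ν := by
  rw [klDiv_eq_lintegral_klFun_of_ac (withDensity_absolutelyContinuous _ _)]
  refine lintegral_congr_ae ?_
  filter_upwards [Measure.rnDeriv_withDensity ν hf] with x hx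
  rw [hx]

-- The divergence integrates `klFun`, which is nonnegative thanks to its mass correction, so
-- discarding a part of the space can only decrease it.
open InformationTheory in
theorem klDiv_restrict_le {α : Type*} [MeasurableSpace α] (μ ν : Measure α)
    [IsFiniteMeasure μ] [IsFiniteMeasure ν] {s : Set α} (hs : MeasurableSet s) :
    klDiv (μ.restrict s) (ν.restrict s) ≤ klDiv μ ν := by
  by_cases hμν : μ ≪ ν
  · have hm := Measure.measurable_rnDeriv μ ν
    have hrep : (ν.withDensity (μ.rnDeriv ν)) = μ := Measure.withDensity_rnDeriv_eq μ ν hμν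
    have hrs : (ν.restrict s).withDensity (μ.rnDeriv ν) = μ.restrict s := by
      rw [← restrict_withDensity hs, hrep]
    have : IsFiniteMeasure ((ν.restrict s).withDensity (μ.rnDeriv ν)) := by
      rw [hrs]; infer_instance
    rw [klDiv_eq_lintegral_klFun_of_ac hμν, ← hrs, klDiv_withDensity_eq_lintegral _ hm]
    exact setLIntegral_le_lintegral _ _
  · rw [klDiv_of_not_ac hμν]
    exact le_top

open InformationTheory in
/-- A lower bound of the probability of an event after a change of measure. -/
theorem log_measureReal_ge_of_klDiv_le {α : Type*} [MeasurableSpace α] (μ ν : Measure α)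
    [IsProbabilityMeasure μ] [IsProbabilityMeasure ν] {s : Set α} (hs : MeasurableSet s)
    {K : ℝ} (hK : klDiv μ ν ≤ ENNReal.ofReal K) (hK0 : 0 ≤ K) (hμ : 0 < μ.real s) :
    0 < ν.real s ∧ Real.log (μ.real s) - (K + 1) / μ.real s ≤ Real.log (ν.real s) := by
  have hac : μ ≪ ν := by
    by_contra h
    rw [klDiv_of_not_ac h] at hK
    exact ENNReal.ofReal_ne_top (top_le_iff.1 hK)
  have hν : 0 < ν.real s := by
    refine ENNReal.toReal_pos (fun h => hμ.ne' ?_) (measure_ne_top _ _)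
    rw [measureReal_def, hac h, ENNReal.toReal_zero]
  refine ⟨hν, ?_⟩
  -- Log-sum inequality on `s`: with p and q the two masses of `s`, p log (p / q) + q - p ≤ K. The
  -- correction p - q ≤ 1 accounts for the `K + 1`.
  have h1 := (mul_log_le_klDiv (μ.restrict s) (ν.restrict s)).trans
    ((klDiv_restrict_le μ ν hs).trans hK)
  rw [ENNReal.ofReal_le_ofReal_iff hK0] at h1
  simp only [measureReal_restrict_apply_univ] at h1
  rw [Real.log_div hμ.ne' hν.ne'] at h1
  have h2 : μ.real s ≤ 1 := measureReal_le_one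
  have h3 : Real.log (μ.real s) - Real.log (ν.real s) ≤ (K + 1) / μ.real s := by
    rw [le_div_iff₀ hμ]
    nlinarith
  linarith

-- The jointly measurable `Kernel.rnDeriv` is a density of one joint law with respect to the other,
-- so the joint divergence is an iterated integral of `klFun`.
open InformationTheory in
theorem klDiv_compProd_right_eq_lintegral {α β : Type*} [MeasurableSpace α] [MeasurableSpace β]
    [MeasurableSpace.CountableOrCountablyGenerated α β] (μ : Measure α) [IsFiniteMeasure μ]
    (κ η : Kernel α β) [IsMarkovKernel κ] [IsMarkovKernel η] (h : ∀ a, κ a ≪ η a) :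
    klDiv (μ ⊗ₘ κ) (μ ⊗ₘ η) = ∫⁻ a, klDiv (κ a) (η a) ∂μ := by
  have hm : Measurable (Function.uncurry (Kernel.rnDeriv κ η)) := Kernel.measurable_rnDeriv κ η
  have hrep : η.withDensity (Kernel.rnDeriv κ η) = κ := by
    ext a : 1
    rw [Kernel.withDensity_apply _ hm]
    conv_rhs => rw [← Measure.withDensity_rnDeriv_eq (κ a) (η a) (h a)]
    exact withDensity_congr_ae Kernel.rnDeriv_eq_rnDeriv_measure
  have hcp : (μ ⊗ₘ η).withDensity (Function.uncurry (Kernel.rnDeriv κ η)) = μ ⊗ₘ κ := by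
    have hs : IsSFiniteKernel (η.withDensity (Kernel.rnDeriv κ η)) := by
      rw [hrep]; infer_instance
    conv_rhs => rw [← hrep]
    exact (Measure.compProd_withDensity hm).symm
  have : IsFiniteMeasure ((μ ⊗ₘ η).withDensity (Function.uncurry (Kernel.rnDeriv κ η))) := by
    rw [hcp]; infer_instance
  rw [← hcp, klDiv_withDensity_eq_lintegral _ hm, Measure.lintegral_compProd]
  · refine lintegral_congr fun a => ?_
    rw [klDiv_eq_lintegral_klFun_of_ac (h a)]
    refine lintegral_congr_ae ?_
    filter_upwards [Kernel.rnDeriv_eq_rnDeriv_measure (κ := κ) (η := η) (a := a)] with x hx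
    rw [Function.uncurry_apply_pair, hx]
  · exact (measurable_klFun.comp hm.ennreal_toReal).ennreal_ofReal
end

/-! ### Divergence decomposition for the laws of histories -/

noncomputable section

theorem map_frestrictLe_zero_trajMeasure {X : ℕ → Type*} [∀ n, MeasurableSpace (X n)]
    (μ₀ : Measure (X 0)) (κ : (n : ℕ) → Kernel (Π i : Finset.Iic n, X i) (X (n + 1)))
    [∀ n, IsMarkovKernel (κ n)] :
    (Kernel.trajMeasure μ₀ κ).map (Preorder.frestrictLe 0) =
      μ₀.map (MeasurableEquiv.piUnique (fun i : Finset.Iic 0 => X i)).symm := by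
  rw [Kernel.trajMeasure, Measure.map_comp _ _ (by fun_prop), Kernel.traj_map_frestrictLe,
    Kernel.partialTraj_self, Measure.id_comp]
  rfl

/-- Appending one coordinate to a finite sequence. -/
def appendCoord {E : Type*} (n : ℕ) (p : (Finset.Iic n → E) × E) (i : Finset.Iic (n + 1)) : E :=
  if h : (i : ℕ) ≤ n then p.1 ⟨i, Finset.mem_Iic.2 h⟩ else p.2

theorem measurable_appendCoord {E : Type*} [MeasurableSpace E] (n : ℕ) :
    Measurable (appendCoord (E := E) n) := by
  refine measurable_pi_lambda _ fun i => ?_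
  unfold appendCoord
  by_cases h : (i : ℕ) ≤ n
  · simp only [h, dite_true]
    fun_prop
  · simp only [h, dite_false]
    fun_prop

open InformationTheory in
/-- One step of the chain rule for the laws of two trajectories. -/
theorem klDiv_map_frestrictLe_succ_le {E : Type*} [MeasurableSpace E]
    {μ ν : Measure E} [IsProbabilityMeasure μ] [IsProbabilityMeasure ν]
    (κ η : (n : ℕ) → Kernel (Finset.Iic n → E) E)
    [∀ n, IsMarkovKernel (κ n)] [∀ n, IsMarkovKernel (η n)] (n : ℕ) :
    klDiv ((Kernel.trajMeasure (X := fun _ => E) μ κ).map (Preorder.frestrictLe (n + 1)))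
        ((Kernel.trajMeasure (X := fun _ => E) ν η).map (Preorder.frestrictLe (n + 1))) ≤
      klDiv ((Kernel.trajMeasure (X := fun _ => E) μ κ).map (Preorder.frestrictLe n))
        ((Kernel.trajMeasure (X := fun _ => E) ν η).map (Preorder.frestrictLe n)) +
      klDiv ((Kernel.trajMeasure (X := fun _ => E) μ κ).map (Preorder.frestrictLe n) ⊗ₘ κ n)
        ((Kernel.trajMeasure (X := fun _ => E) μ κ).map (Preorder.frestrictLe n) ⊗ₘ η n) := by
  have hglue : (Preorder.frestrictLe (π := fun _ => E) (n + 1)) =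
      appendCoord n ∘ fun x => (Preorder.frestrictLe n x, x (n + 1)) := by
    funext x i
    obtain ⟨i, hi⟩ := i
    by_cases h : i ≤ n
    · simp [appendCoord, h]
    · obtain rfl : i = n + 1 := by have := Finset.mem_Iic.1 hi; omega
      simp [appendCoord]
  have key : ∀ (μ : Measure E) [IsProbabilityMeasure μ]
      (κ : (n : ℕ) → Kernel (Finset.Iic n → E) E) [∀ n, IsMarkovKernel (κ n)],
      (Kernel.trajMeasure (X := fun _ => E) μ κ).map (Preorder.frestrictLe (n + 1)) =
        ((Kernel.trajMeasure (X := fun _ => E) μ κ).map (Preorder.frestrictLe n) ⊗ₘ κ n).map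
          (appendCoord n) := by
    intro μ _ κ _
    rw [Kernel.map_frestrictLe_trajMeasure_compProd_eq_map_trajMeasure, hglue,
      Measure.map_map (measurable_appendCoord n) (by fun_prop)]
  have := Measure.isProbabilityMeasure_map (μ := Kernel.trajMeasure (X := fun _ => E) μ κ)
    (f := Preorder.frestrictLe (π := fun _ => E) n) (by fun_prop)
  have := Measure.isProbabilityMeasure_map (μ := Kernel.trajMeasure (X := fun _ => E) ν η)
    (f := Preorder.frestrictLe (π := fun _ => E) n) (by fun_prop)
  rw [key μ κ, key ν η, ← klDiv_compProd_eq_add]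
  -- Only an inequality is needed, so data processing suffices and no inverse of `appendCoord` is
  -- required.
  exact klDiv_map_le _ _ (measurable_appendCoord n)

variable (π : BanditAlgorithm) (ν ν' : Fin 2 → Measure ℝ) [∀ k, IsProbabilityMeasure (ν k)]
  [∀ k, IsProbabilityMeasure (ν' k)]

instance : IsProbabilityMeasure (π.interaction ν) := by
  unfold BanditAlgorithm.interaction
  infer_instance

-- The drawn arm is part of the common first marginal `m`, and both environments reward the arms
-- other than `j` alike: only draws of `j` contribute.
open InformationTheory in
theorem klDiv_compProd_rewardKernel_le {α : Type*} [MeasurableSpace α] (m : Measure (α × Fin 2))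
    [IsProbabilityMeasure m] (j : Fin 2)
    (hac : ν j ≪ ν' j) (heq : ∀ i, i ≠ j → ν i = ν' i) :
    klDiv (m ⊗ₘ Kernel.prodMkLeft α (rewardKernel ν)) (m ⊗ₘ Kernel.prodMkLeft α (rewardKernel ν'))
      ≤ m.map Prod.snd {j} * klDiv (ν j) (ν' j) := by
  have hrw : ∀ (ν : Fin 2 → Measure ℝ) (a : α × Fin 2),
      Kernel.prodMkLeft α (rewardKernel ν) a = ν a.2 := fun ν a => rfl
  have hs : MeasurableSet (Prod.snd ⁻¹' {j} : Set (α × Fin 2)) :=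
    measurable_snd (measurableSet_singleton j)
  rw [klDiv_compProd_right_eq_lintegral, Measure.map_apply measurable_snd (by simp), mul_comm,
    ← setLIntegral_const, ← lintegral_indicator hs]
  · refine lintegral_mono fun a => ?_
    rw [hrw, hrw]
    by_cases h : a.2 = j
    · rw [indicator_of_mem (by exact h), h]
    · rw [heq _ h, klDiv_self]
      exact zero_le
  · intro a
    rw [hrw, hrw]
    by_cases h : a.2 = j
    · rw [h]; exact hac
    · rw [heq _ h]

open InformationTheory in
/-- The divergence decomposition for two environments that differ in the arm `j` only. -/
theorem klDiv_interaction_le (j : Fin 2) (hac : ν j ≪ ν' j) (heq : ∀ i, i ≠ j → ν i = ν' i)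
    (n : ℕ) :
    klDiv ((π.interaction ν).map (Preorder.frestrictLe n))
        ((π.interaction ν').map (Preorder.frestrictLe n)) ≤
      (∑ i ∈ Finset.range (n + 1), π.interaction ν {ω | (ω i).1 = j}) * klDiv (ν j) (ν' j) := by
  induction n with
  | zero =>
    have h0 : ∀ (ν : Fin 2 → Measure ℝ) [∀ k, IsProbabilityMeasure (ν k)],
        (π.interaction ν).map (Preorder.frestrictLe 0) = (π.first ⊗ₘ rewardKernel ν).map
          (MeasurableEquiv.piUnique (fun _ : Finset.Iic 0 => Fin 2 × ℝ)).symm :=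
      fun ν _ => map_frestrictLe_zero_trajMeasure _ _
    have h1 : π.interaction ν {ω | (ω 0).1 = j} = π.first {j} := by
      have e1 : {ω : ℕ → Fin 2 × ℝ | (ω 0).1 = j} = Preorder.frestrictLe 0 ⁻¹'
          {x : (i : Finset.Iic 0) → Fin 2 × ℝ | (x ⟨0, by simp⟩).1 = j} := by
        ext; simp
      have hm : MeasurableSet {x : (i : Finset.Iic 0) → Fin 2 × ℝ | (x ⟨0, by simp⟩).1 = j} :=
        (measurable_fst.comp (measurable_pi_apply _)) (measurableSet_singleton j)
      have e2 : (MeasurableEquiv.piUnique (fun _ : Finset.Iic 0 => Fin 2 × ℝ)).symm ⁻¹'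
          {x : (i : Finset.Iic 0) → Fin 2 × ℝ | (x ⟨0, by simp⟩).1 = j} = Prod.fst ⁻¹' {j} := by
        ext x
        rfl
      rw [e1, ← Measure.map_apply (by fun_prop) hm, h0, Measure.map_apply (by fun_prop) hm, e2,
        ← Measure.fst_apply (measurableSet_singleton j), Measure.fst_compProd]
    rw [h0, h0, zero_add, Finset.sum_range_one, h1]
    refine (klDiv_map_le _ _ (by fun_prop)).trans ?_
    rw [klDiv_compProd_right_eq_lintegral, mul_comm, ← setLIntegral_const,
      ← lintegral_indicator (measurableSet_singleton j)]
    · refine lintegral_mono fun a => ?_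
      change klDiv (ν a) (ν' a) ≤ _
      by_cases h : a = j
      · rw [indicator_of_mem (by exact h), h]
      · rw [heq _ h, klDiv_self]
        exact zero_le
    · intro a
      change ν a ≪ ν' a
      by_cases h : a = j
      · rw [h]; exact hac
      · rw [heq _ h]
  | succ n ih =>
    have := Measure.isProbabilityMeasure_map (μ := π.interaction ν)
      (f := Preorder.frestrictLe (π := fun _ => Fin 2 × ℝ) n) (by fun_prop)
    rw [Finset.sum_range_succ, add_mul]
    refine (klDiv_map_frestrictLe_succ_le _ _ n).trans (add_le_add ih ?_)
    change klDiv ((π.interaction ν).map (Preorder.frestrictLe n) ⊗ₘ _)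
      ((π.interaction ν).map (Preorder.frestrictLe n) ⊗ₘ _) ≤ _
    -- The joint law of history and next arm. The algorithm does not know the environment, so `m` is
    -- common to both measures compared here; only the reward kernels differ.
    set m := (π.interaction ν).map (Preorder.frestrictLe n) ⊗ₘ π.next n with hm
    have hassoc : ∀ (ρ : Fin 2 → Measure ℝ) [∀ k, IsProbabilityMeasure (ρ k)],
        (π.interaction ν).map (Preorder.frestrictLe n) ⊗ₘ
          (π.next n ⊗ₖ Kernel.prodMkLeft (History n) (rewardKernel ρ)) =
        (m ⊗ₘ Kernel.prodMkLeft (History n) (rewardKernel ρ)).map MeasurableEquiv.prodAssoc :=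
      fun ρ _ => Measure.compProd_assoc'.symm
    have harm : m.map Prod.snd {j} = π.interaction ν {ω | (ω (n + 1)).1 = j} := by
      have hj := measurableSet_singleton j
      have h1 : m = ((π.interaction ν).map (Preorder.frestrictLe n) ⊗ₘ
          (π.next n ⊗ₖ Kernel.prodMkLeft (History n) (rewardKernel ν))).map
            (fun p => (p.1, p.2.1)) := by
        rw [hassoc, Measure.map_map (by fun_prop) (by fun_prop)]
        exact (Measure.fst_compProd m _).symm
      have h2 : (π.interaction ν).map (Preorder.frestrictLe n) ⊗ₘ
          (π.next n ⊗ₖ Kernel.prodMkLeft (History n) (rewardKernel ν)) =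
          (π.interaction ν).map (fun x => (Preorder.frestrictLe n x, x (n + 1))) :=
        Kernel.map_frestrictLe_trajMeasure_compProd_eq_map_trajMeasure
      rw [h1, h2, Measure.map_map (by fun_prop) (by fun_prop),
        Measure.map_map (by fun_prop) (by fun_prop), Measure.map_apply (by fun_prop) hj]
      rfl
    rw [hassoc, hassoc, ← harm]
    exact (klDiv_map_le _ _ (by fun_prop)).trans (klDiv_compProd_rewardKernel_le ν ν' m j hac heq)

/-! ### Counts of plays and the change of environment -/

theorem measurable_numPlays (k : Fin 2) (T : ℕ) : Measurable (numPlays k T) := by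
  have : numPlays k T = fun ω => ∑ t ∈ Finset.range T,
      (if (ω t).1 = k then 1 else 0) := by
    funext ω
    rw [numPlays, Finset.card_filter]
  rw [this]
  refine Finset.measurable_sum _ fun t _ => Measurable.ite ?_ measurable_const measurable_const
  exact (measurable_fst.comp (measurable_pi_apply t)) (measurableSet_singleton k)

theorem numPlays_le (k : Fin 2) (T : ℕ) (ω : ℕ → Fin 2 × ℝ) : numPlays k T ω ≤ T :=
  (Finset.card_filter_le _ _).trans_eq (Finset.card_range T)

theorem numPlays_mono (k : Fin 2) (ω : ℕ → Fin 2 × ℝ) : Monotone fun T => numPlays k T ω :=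
  fun _ _ h => Finset.card_le_card (Finset.filter_subset_filter _ (Finset.range_mono h))

theorem numPlays_add_numPlays {j k : Fin 2} (hjk : j ≠ k) (T : ℕ) (ω : ℕ → Fin 2 × ℝ) :
    numPlays j T ω + numPlays k T ω = T := by
  have h : ∀ t, (ω t).1 = k ↔ ¬ (ω t).1 = j := fun t => by omega
  rw [numPlays, numPlays, Finset.filter_congr fun t _ => h t,
    Finset.card_filter_add_card_filter_not, Finset.card_range]

theorem integrable_numPlays (μ : Measure (ℕ → Fin 2 × ℝ)) [IsFiniteMeasure μ] (k : Fin 2)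
    (T : ℕ) : Integrable (fun ω => (numPlays k T ω : ℝ)) μ := by
  refine Integrable.of_bound (C := T)
    (measurable_from_nat.comp (measurable_numPlays k T)).aestronglyMeasurable (ae_of_all _ fun ω => ?_)
  rw [Real.norm_natCast]
  exact_mod_cast numPlays_le k T ω

theorem ofReal_integral_numPlays (μ : Measure (ℕ → Fin 2 × ℝ)) [IsFiniteMeasure μ] (k : Fin 2)
    (T : ℕ) : ENNReal.ofReal (∫ ω, (numPlays k T ω : ℝ) ∂μ) =
      ∑ i ∈ Finset.range T, μ {ω | (ω i).1 = k} := by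
  rw [ofReal_integral_eq_lintegral_ofReal (integrable_numPlays μ k T)
    (ae_of_all _ fun ω => Nat.cast_nonneg _)]
  have hs : ∀ i, MeasurableSet {ω : ℕ → Fin 2 × ℝ | (ω i).1 = k} := fun i =>
    (measurable_fst.comp (measurable_pi_apply i)) (measurableSet_singleton k)
  have : ∀ ω : ℕ → Fin 2 × ℝ, ENNReal.ofReal (numPlays k T ω : ℝ) =
      ∑ i ∈ Finset.range T, {ω : ℕ → Fin 2 × ℝ | (ω i).1 = k}.indicator 1 ω := by
    intro ω
    rw [ENNReal.ofReal_natCast, numPlays, Finset.card_filter, Nat.cast_sum]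
    refine Finset.sum_congr rfl fun i _ => ?_
    simp [indicator_apply]
  simp_rw [this]
  rw [lintegral_finsetSum _ fun i _ => measurable_one.indicator (hs i)]
  exact Finset.sum_congr rfl fun i _ => lintegral_indicator_one (hs i)

/-- The event that arm `k` is played at least `x` times up to time `n + 1`, as an event on
histories. -/
theorem exists_preimage_frestrictLe_numPlays (k : Fin 2) (n : ℕ) (x : ℝ) :
    ∃ s : Set (History n), MeasurableSet s ∧
      {ω | x ≤ numPlays k (n + 1) ω} = Preorder.frestrictLe n ⁻¹' s := by
  -- Padding by dummy plays after time `n`, which the count over the plays `0, …, n` never sees.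
  let e : History n → ℕ → Fin 2 × ℝ := fun h i =>
    if hi : i ≤ n then h ⟨i, Finset.mem_Iic.2 hi⟩ else (0, 0)
  have he : Measurable e := by
    refine measurable_pi_lambda _ fun i => ?_
    by_cases hi : i ≤ n
    · simp only [e, hi, dite_true]; fun_prop
    · simp only [e, hi, dite_false]; fun_prop
  refine ⟨{h | x ≤ numPlays k (n + 1) (e h)}, measurableSet_le measurable_const
    (measurable_from_nat.comp ((measurable_numPlays k _).comp he)), ?_⟩
  ext ω
  have : numPlays k (n + 1) (e (Preorder.frestrictLe n ω)) = numPlays k (n + 1) ω := by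
    unfold numPlays
    congr 1
    refine Finset.filter_congr fun i hi => ?_
    have : i ≤ n := by have := Finset.mem_range.1 hi; omega
    simp [e, this]
  simp only [mem_preimage, mem_ofPred_eq, this]

open InformationTheory in
/-- A lower bound for the probability of many plays of arm `k`, in terms of an environment `ν` that
differs in the arm `j` only. -/
theorem log_numPlays_ge (j k : Fin 2) (hac : ν j ≪ ν' j) (heq : ∀ i, i ≠ j → ν i = ν' i)
    (hfin : klDiv (ν j) (ν' j) ≠ ⊤) (T : ℕ) (hT : T ≠ 0) (x : ℝ)
    (hpos : 0 < (π.interaction ν).real {ω | x ≤ numPlays k T ω}) :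
    0 < (π.interaction ν').real {ω | x ≤ numPlays k T ω} ∧
    Real.log ((π.interaction ν).real {ω | x ≤ numPlays k T ω}) -
      ((∫ ω, (numPlays j T ω : ℝ) ∂(π.interaction ν)) * (klDiv (ν j) (ν' j)).toReal + 1) /
        (π.interaction ν).real {ω | x ≤ numPlays k T ω} ≤
      Real.log ((π.interaction ν').real {ω | x ≤ numPlays k T ω}) := by
  obtain ⟨n, rfl⟩ := Nat.exists_eq_succ_of_ne_zero hT
  obtain ⟨s, hs, hsx⟩ := exists_preimage_frestrictLe_numPlays k n x
  have hmeas : Measurable (Preorder.frestrictLe (π := fun _ => Fin 2 × ℝ) n) := by fun_prop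
  have := Measure.isProbabilityMeasure_map (μ := π.interaction ν) hmeas.aemeasurable
  have := Measure.isProbabilityMeasure_map (μ := π.interaction ν') hmeas.aemeasurable
  have h0 : 0 ≤ ∫ ω, (numPlays j (n + 1) ω : ℝ) ∂(π.interaction ν) :=
    integral_nonneg fun ω => Nat.cast_nonneg _
  have hr : ∀ μ : Measure (ℕ → Fin 2 × ℝ),
      μ.real {ω | x ≤ numPlays k (n + 1) ω} = (μ.map (Preorder.frestrictLe n)).real s := by
    intro μ
    rw [hsx, map_measureReal_apply hmeas hs]
  rw [Nat.succ_eq_add_one, hr, hr]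
  rw [Nat.succ_eq_add_one, hr] at hpos
  refine log_measureReal_ge_of_klDiv_le _ _ hs ?_ (mul_nonneg h0 ENNReal.toReal_nonneg) hpos
  rw [ENNReal.ofReal_mul h0, ENNReal.ofReal_toReal hfin, ofReal_integral_numPlays]
  exact klDiv_interaction_le π ν ν' j hac heq n

end

/-! ### Divergences within the exponential family -/

noncomputable section
namespace ExpFamily

variable (F : ExpFamily)

/-- The mean of the law with parameter `θ`. -/
def mean (θ : ℝ) : ℝ := ∫ x, x ∂F.law θ

theorem measurable_density (θ : ℝ) : Measurable (F.density θ) := by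
  have := F.measurable_h
  unfold density
  fun_prop

theorem density_nonneg (θ x : ℝ) : 0 ≤ F.density θ x :=
  mul_nonneg (F.h_nonneg x) (Real.exp_pos _).le

theorem law_eq_withDensity_law (θ θ' : ℝ) :
    F.law θ = (F.law θ').withDensity
      fun x => ENNReal.ofReal (Real.exp (x * (θ - θ') - (F.A θ - F.A θ'))) := by
  rw [law, law, ← withDensity_mul _ (F.measurable_density θ').ennreal_ofReal (by fun_prop)]
  congr 1
  funext x
  rw [Pi.mul_apply, ← ENNReal.ofReal_mul (F.density_nonneg θ' x), density, density, mul_assoc,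
    ← Real.exp_add]
  congr 3
  ring

theorem law_absolutelyContinuous (θ θ' : ℝ) : F.law θ ≪ F.law θ' := by
  rw [F.law_eq_withDensity_law θ θ']
  exact withDensity_absolutelyContinuous _ _

theorem integrable_id_law (θ : F.Θ) : Integrable (fun x => x) (F.law θ) := by
  rw [law, integrable_withDensity_iff (F.measurable_density θ).ennreal_ofReal
    (ae_of_all _ fun x => ENNReal.ofReal_lt_top)]
  refine ((F.finite_mean θ θ.2).mul_const (Real.exp (-F.A θ))).congr (ae_of_all _ fun x => ?_)
  beta_reduce
  rw [ENNReal.toReal_ofReal (F.density_nonneg θ x), density, sub_eq_add_neg, Real.exp_add]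
  ring

theorem llr_law (θ θ' : F.Θ) :
    llr (F.law θ) (F.law θ') =ᵐ[F.law θ]
      fun x => x * ((θ : ℝ) - θ') - (F.A θ - F.A θ') := by
  refine (F.law_absolutelyContinuous θ θ').ae_le ?_
  have h := Measure.rnDeriv_withDensity (F.law θ')
    (f := fun x => ENNReal.ofReal (Real.exp (x * ((θ : ℝ) - θ') - (F.A θ - F.A θ')))) (by fun_prop)
  rw [← F.law_eq_withDensity_law] at h
  filter_upwards [h] with x hx
  rw [llr, hx, ENNReal.toReal_ofReal (Real.exp_pos _).le, Real.log_exp]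

theorem integrable_llr_law (θ θ' : F.Θ) :
    Integrable (llr (F.law θ) (F.law θ')) (F.law θ) :=
  (((F.integrable_id_law θ).mul_const _).sub (integrable_const _)).congr (F.llr_law θ θ').symm

theorem klDiv_law_ne_top (θ θ' : F.Θ) :
    InformationTheory.klDiv (F.law θ) (F.law θ') ≠ ⊤ :=
  InformationTheory.klDiv_ne_top (F.law_absolutelyContinuous θ θ') (F.integrable_llr_law θ θ')

/-- The log-likelihood ratio is affine in the observation, so its expectation involves only the
mean. Using `mean` rather than A' keeps this valid at boundary points of Θ. -/
theorem D_eq (θ θ' : F.Θ) :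
    F.D θ θ' = F.mean θ * ((θ : ℝ) - θ') - (F.A θ - F.A θ') := by
  rw [D, InformationTheory.toReal_klDiv_of_measure_eq (F.law_absolutelyContinuous θ θ') (by simp),
    integral_congr_ae (F.llr_law θ θ'),
    integral_sub ((F.integrable_id_law θ).mul_const _) (integrable_const _), integral_mul_const]
  simp [mean]

theorem D_nonneg (θ θ' : ℝ) : 0 ≤ F.D θ θ' := ENNReal.toReal_nonneg

theorem integral_withDensity_h (g : ℝ → ℝ) :
    ∫ x, g x ∂(F.ρ.withDensity fun x => ENNReal.ofReal (F.h x)) = ∫ x, F.h x * g x ∂F.ρ := by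
  rw [integral_withDensity_eq_integral_toReal_smul F.measurable_h.ennreal_ofReal
    (ae_of_all _ fun x => ENNReal.ofReal_lt_top)]
  simp [ENNReal.toReal_ofReal (F.h_nonneg _)]

/-- Together with `A_eq_cgf`, this makes the convexity of Θ and the derivative of A available from
the theory of cumulant generating functions. -/
theorem Θ_eq_integrableExpSet :
    F.Θ = integrableExpSet id (F.ρ.withDensity fun x => ENNReal.ofReal (F.h x)) := by
  ext θ
  simp only [Θ, integrableExpSet, mem_ofPred_eq]
  rw [integrable_withDensity_iff F.measurable_h.ennreal_ofReal
    (ae_of_all _ fun x => ENNReal.ofReal_lt_top)]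
  refine integrable_congr (ae_of_all _ fun x => ?_)
  simp only [ENNReal.toReal_ofReal (F.h_nonneg _), id, mul_comm]

theorem A_eq_cgf :
    F.A = cgf id (F.ρ.withDensity fun x => ENNReal.ofReal (F.h x)) := by
  funext θ
  rw [A, cgf, mgf, F.integral_withDensity_h]
  simp only [id, mul_comm]

theorem mean_eq (θ : F.Θ) :
    F.mean θ = (∫ x, x * (F.h x * Real.exp (x * θ)) ∂F.ρ) /
      ∫ x, F.h x * Real.exp (x * θ) ∂F.ρ := by
  rw [mean, law, integral_withDensity_eq_integral_toReal_smul
    (F.measurable_density θ).ennreal_ofReal (ae_of_all _ fun x => ENNReal.ofReal_lt_top),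
    div_eq_mul_inv, ← Real.exp_log (F.integral_pos θ.2), ← Real.exp_neg, ← integral_mul_const]
  refine integral_congr_ae (ae_of_all _ fun x => ?_)
  beta_reduce
  rw [ENNReal.toReal_ofReal (F.density_nonneg θ x), density, sub_eq_add_neg, Real.exp_add,
    smul_eq_mul, A]
  ring

theorem deriv_A {θ : ℝ} (hθ : θ ∈ interior F.Θ) : deriv F.A θ = F.mean θ := by
  have h1 : θ ∈ F.Θ := interior_subset hθ
  rw [F.Θ_eq_integrableExpSet] at hθ
  rw [F.mean_eq ⟨θ, h1⟩, F.A_eq_cgf, deriv_cgf hθ, mgf, F.integral_withDensity_h,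
    F.integral_withDensity_h]
  congr 1
  · exact integral_congr_ae (ae_of_all _ fun x => by simp only [id]; ring_nf)
  · exact integral_congr_ae (ae_of_all _ fun x => by simp only [id]; ring_nf)

theorem Iic_subset_Θ (hΘ : ¬ BddBelow F.Θ) {θ : ℝ} (hθ : θ ∈ F.Θ) : Iic θ ⊆ F.Θ := by
  intro s hs
  obtain ⟨r, hr, hrs⟩ := not_bddBelow_iff.1 hΘ s
  have hc : Convex ℝ F.Θ := by
    rw [F.Θ_eq_integrableExpSet]
    exact convex_integrableExpSet
  exact hc.ordConnected.out hr hθ ⟨hrs.le, hs⟩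

/-- With m the mean at θ and G = D(θ, θ₂), one has D(θ, θ₁) = G - m (θ₁ - θ₂) + A(θ₁) - A(θ₂). So it
suffices that G be large and -m small relative to G. The latter holds because D(θ, θ₂ - K) ≥ 0 reads
-m K ≤ G + A(θ₂ - K) - A(θ₂), for K as large as desired. -/
theorem exists_D_div_D_le (hF : F.LeftTailCondition) {θ₁ θ₂ : F.Θ} (h12 : θ₂ < θ₁) {ε : ℝ}
    (hε : 0 < ε) : ∃ θ : F.Θ, θ < θ₂ ∧ F.D θ θ₁ / F.D θ θ₂ ≤ 1 + ε := by
  obtain ⟨hΘ, htail⟩ := hF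
  have h12' : 0 < (θ₁ : ℝ) - θ₂ := sub_pos.2 h12
  set K : ℝ := 2 * ((θ₁ : ℝ) - θ₂) / ε with hK
  have hKpos : 0 < K := by positivity
  have hIic := F.Iic_subset_Θ hΘ θ₂.2
  set s : F.Θ := ⟨θ₂ - K, hIic (by simp [hKpos.le])⟩ with hs
  set s₁ : F.Θ := ⟨θ₂ - 1, hIic (by simp)⟩ with hs₁
  -- Once G ≥ R, the additive constants cost at most ε / 2 * G; the choice of K makes the term in -m
  -- cost another ε / 2 * G.
  set R : ℝ := max 1 ((F.A s - F.A θ₂) + 2 * (F.A θ₁ - F.A θ₂) / ε) with hR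
  set B : ℝ := R + F.A s₁ - F.A θ₂ with hB
  obtain ⟨t, hu, ht⟩ := ((htail.eventually_ge_atTop
    (R - F.A θ₂ + |(θ₂ : ℝ)| * (|B| + |F.mean θ₂|))).and (eventually_lt_atBot (θ₂ : ℝ))).exists
  have htint : t ∈ interior F.Θ :=
    interior_maximal (Iio_subset_Iic_self.trans hIic) isOpen_Iio ht
  rw [F.deriv_A htint] at hu
  set θ : F.Θ := ⟨t, hIic ht.le⟩ with hθ
  refine ⟨θ, ht, ?_⟩
  have d1 := F.D_eq θ θ₁
  have d2 := F.D_eq θ θ₂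
  have ds := F.D_eq θ s
  have ds1 := F.D_eq θ s₁
  have d3 := F.D_eq θ₂ θ
  have ns := F.D_nonneg θ s
  have ns1 := F.D_nonneg θ s₁
  have n2 := F.D_nonneg θ θ₂
  have n3 := F.D_nonneg θ₂ θ
  simp only [hθ, hs, hs₁] at d1 d2 ds ds1 d3 ns ns1 n2 n3 hB hR ⊢
  set m := F.mean t
  set a₁ := F.A θ₁
  set a₂ := F.A θ₂
  set as := F.A (θ₂ - K)
  set as₁ := F.A (θ₂ - 1)
  set G := F.D t θ₂
  -- The mean is monotone: D(θ, θ₂) + D(θ₂, θ) = (m - mean θ₂) (θ - θ₂) ≥ 0.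
  have hm : m ≤ F.mean θ₂ := by
    by_contra hcon
    push Not at hcon
    nlinarith
  have hGR : R ≤ G := by
    -- A very negative mean forces G ≥ R through D(θ, θ₂ - 1) ≥ 0. Otherwise m is bounded and the
    -- tail condition, in the form of `hu`, makes G large.
    rcases le_or_gt m (-B) with hmB | hmB
    · nlinarith
    · have h1 : |m| ≤ |B| + |F.mean θ₂| := by
        rw [abs_le]
        constructor
        · linarith [le_abs_self B, abs_nonneg (F.mean θ₂)]
        · linarith [abs_nonneg B, le_abs_self (F.mean θ₂)]
      have h2 : (θ₂ : ℝ) * m ≤ |(θ₂ : ℝ)| * (|B| + |F.mean θ₂|) :=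
        (le_abs_self _).trans ((abs_mul _ _).trans_le (mul_le_mul_of_nonneg_left h1 (abs_nonneg _)))
      nlinarith
  have hG1 : 1 ≤ G := (le_max_left _ _).trans hGR
  have hG2 : (as - a₂) + 2 * (a₁ - a₂) / ε ≤ G := (le_max_right _ _).trans hGR
  have hKm : -m * K ≤ G + as - a₂ := by nlinarith
  have hKε : ε / 2 * K = (θ₁ : ℝ) - θ₂ := by
    rw [hK]; field_simp
  rw [div_le_iff₀ (by linarith)]
  have h3 : ε / 2 * ((as - a₂) + 2 * (a₁ - a₂) / ε) ≤ ε / 2 * G :=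
    mul_le_mul_of_nonneg_left hG2 (by positivity)
  have h4 : ε / 2 * ((as - a₂) + 2 * (a₁ - a₂) / ε) = ε / 2 * (as - a₂) + (a₁ - a₂) := by
    field_simp
  have h5 : -m * ((θ₁ : ℝ) - θ₂) ≤ ε / 2 * (G + as - a₂) := by
    rw [← hKε]
    nlinarith [mul_le_mul_of_nonneg_left hKm (by positivity : 0 ≤ ε / 2)]
  have h6 : F.D t θ₁ = G - m * ((θ₁ : ℝ) - θ₂) + (a₁ - a₂) := by
    rw [d1, d2]; ring
  rw [h6]
  nlinarith

end ExpFamily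
end

/-! ### Tail bounds for an optimized algorithm -/

noncomputable section
namespace ExpFamily

variable (F : ExpFamily)

instance (π : BanditAlgorithm) (ν : Fin 2 → F.Θ) : IsProbabilityMeasure (F.banditLaw π ν) := by
  unfold banditLaw
  infer_instance

theorem mul_measureReal_le_integral_numPlays (π : BanditAlgorithm) (ν : Fin 2 → F.Θ) (k : Fin 2)
    (T : ℕ) (x : ℝ) :
    x * (F.banditLaw π ν).real {ω | x ≤ numPlays k T ω} ≤
      ∫ ω, (numPlays k T ω : ℝ) ∂F.banditLaw π ν :=
  mul_meas_ge_le_integral_of_nonneg (ae_of_all _ fun _ => Nat.cast_nonneg _)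
    (integrable_numPlays _ k T) x

/-- Since 1 / (1 - γ) ≥ 1 + γ. The slack γ x - 1 is the number of plays that arm `j` must exceed if
arm `k` is played fewer than x times. -/
theorem le_floor_div_one_sub {γ : ℝ} (hγ : γ ∈ Ioo (0 : ℝ) 1) {x : ℝ} (hx : 0 ≤ x) :
    x + (γ * x - 1) ≤ (⌊x / (1 - γ)⌋₊ : ℝ) := by
  obtain ⟨h0, h1⟩ := hγ
  have h2 : x + γ * x ≤ x / (1 - γ) := by
    rw [le_div_iff₀ (by linarith)]
    nlinarith [mul_nonneg hx (sq_nonneg γ)]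
  linarith [Nat.lt_floor_add_one (x / (1 - γ))]

theorem tendsto_floor_div_one_sub {γ : ℝ} (hγ : γ ∈ Ioo (0 : ℝ) 1) :
    Tendsto (fun x : ℝ => ⌊x / (1 - γ)⌋₊) atTop atTop :=
  tendsto_nat_floor_atTop.comp (tendsto_id.atTop_div_const (sub_pos.2 hγ.2))

theorem tendsto_log_floor_div_log {γ : ℝ} (hγ : γ ∈ Ioo (0 : ℝ) 1) :
    Tendsto (fun x : ℝ => Real.log ⌊x / (1 - γ)⌋₊ / Real.log x) atTop (𝓝 1) := by
  have h1γ : 0 < 1 - γ := sub_pos.2 hγ.2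
  have hup : Tendsto (fun x : ℝ => 1 + (-Real.log (1 - γ)) / Real.log x) atTop (𝓝 1) := by
    simpa using tendsto_const_nhds.add (tendsto_const_nhds.div_atTop Real.tendsto_log_atTop)
  refine tendsto_of_tendsto_of_tendsto_of_le_of_le' tendsto_const_nhds hup ?_ ?_
  · filter_upwards [eventually_gt_atTop 1, eventually_ge_atTop γ⁻¹] with x hx hx2
    have hlx := Real.log_pos hx
    rw [le_div_iff₀ hlx, one_mul]
    refine Real.log_le_log (by linarith) ?_
    have : 1 ≤ γ * x := by
      rw [inv_le_iff_one_le_mul₀ hγ.1] at hx2; linarith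
    linarith [le_floor_div_one_sub hγ (x := x) (by linarith)]
  · filter_upwards [eventually_gt_atTop 1,
      (tendsto_floor_div_one_sub hγ).eventually_gt_atTop 0] with x hx hx2
    have hlx := Real.log_pos hx
    rw [div_le_iff₀ hlx, add_mul, div_mul_cancel₀ _ hlx.ne', one_mul, ← sub_eq_add_neg,
      ← Real.log_div (by linarith) h1γ.ne']
    exact Real.log_le_log (by exact_mod_cast hx2) (Nat.floor_le (by positivity))

theorem tendsto_log_div_mul_sub_one {γ : ℝ} (hγ : 0 < γ) :
    Tendsto (fun x : ℝ => Real.log x / (γ * x - 1)) atTop (𝓝 0) := by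
  have h1 : Tendsto (fun x : ℝ => Real.log x / x) atTop (𝓝 0) :=
    Real.isLittleO_log_id_atTop.tendsto_div_nhds_zero
  have h2 : Tendsto (fun x : ℝ => γ - x⁻¹) atTop (𝓝 γ) := by
    simpa using (tendsto_const_nhds (x := γ)).sub (tendsto_inv_atTop_zero (𝕜 := ℝ))
  have h3 := h1.div h2 hγ.ne'
  rw [zero_div] at h3
  refine h3.congr' ?_
  filter_upwards [eventually_gt_atTop 0] with x hx
  rw [Pi.div_apply, div_div]
  congr 1
  field_simp

variable {F} {π : BanditAlgorithm}

/-- The lower bound for the tail of `N_k(T)` when `T` is the integer part of `x / (1 - γ)`. -/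
theorem IsOptimized.eventually_log_numPlays_floor_ge (hπ : F.IsOptimized π) {ν : Fin 2 → F.Θ}
    {j k : Fin 2} (hjk : ν k < ν j) {γ : ℝ} (hγ : γ ∈ Ioo (0 : ℝ) 1) {θ : F.Θ} (hθ : θ < ν k)
    {ε : ℝ} (hε : 0 < ε) :
    ∀ᶠ x : ℝ in atTop,
      0 < (F.banditLaw π ν).real {ω | x ≤ numPlays k ⌊x / (1 - γ)⌋₊ ω} ∧
      -(F.D θ (ν j) / F.D θ (ν k)) - ε ≤
        Real.log ((F.banditLaw π ν).real {ω | x ≤ numPlays k ⌊x / (1 - γ)⌋₊ ω}) / Real.log x := by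
  have hne : j ≠ k := by rintro rfl; exact lt_irrefl _ hjk
  set ν' : Fin 2 → F.Θ := Function.update ν j θ with hν'
  have hj : ν' j = θ := Function.update_self ..
  have hk : ∀ i, i ≠ j → ν' i = ν i := fun i hi => Function.update_of_ne hi ..
  set f : ℝ → ℝ := fun x =>
    ∫ ω, (numPlays j ⌊x / (1 - γ)⌋₊ ω : ℝ) ∂F.banditLaw π ν' with hf
  have hlim := hπ ν' k j (by rw [hj, hk k hne.symm]; exact hθ)
  rw [hj, hk k hne.symm] at hlim
  have hflog : Tendsto (fun x => f x / Real.log x) atTop (𝓝 (1 / F.D θ (ν k))) := by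
    have h := (hlim.comp (tendsto_floor_div_one_sub hγ)).mul (tendsto_log_floor_div_log hγ)
    rw [mul_one] at h
    refine h.congr' ?_
    filter_upwards [(tendsto_floor_div_one_sub hγ).eventually_gt_atTop 1] with x hx
    have : Real.log (⌊x / (1 - γ)⌋₊ : ℝ) ≠ 0 := (Real.log_pos (by exact_mod_cast hx)).ne'
    simp only [Function.comp_apply, hf]
    rw [div_mul_div_cancel₀ this]
  have hfx : Tendsto (fun x => f x / (γ * x - 1)) atTop (𝓝 0) := by
    have h := hflog.mul (tendsto_log_div_mul_sub_one hγ.1)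
    rw [mul_zero] at h
    refine h.congr' ?_
    filter_upwards [eventually_gt_atTop 1] with x hx
    rw [div_mul_div_cancel₀ (Real.log_pos hx).ne']
  set q : ℝ → ℝ := fun x =>
    (F.banditLaw π ν').real {ω | x ≤ numPlays k ⌊x / (1 - γ)⌋₊ ω} with hq
  -- If N_k < x then N_j exceeds γ x - 1, which Markov's inequality makes unlikely: under `ν'` the
  -- mean of N_j is O(log x).
  have hq1 : Tendsto q atTop (𝓝 1) := by
    have hlow : Tendsto (fun x => 1 - f x / (γ * x - 1)) atTop (𝓝 1) := by
      simpa using tendsto_const_nhds.sub hfx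
    refine tendsto_of_tendsto_of_tendsto_of_le_of_le' hlow tendsto_const_nhds ?_
      (Eventually.of_forall fun x => measureReal_le_one)
    filter_upwards [eventually_gt_atTop 0, eventually_gt_atTop γ⁻¹] with x hx hx2
    have hγx : 0 < γ * x - 1 := by
      rw [inv_lt_iff_one_lt_mul₀ hγ.1] at hx2; linarith
    have hmarkov := F.mul_measureReal_le_integral_numPlays π ν' j ⌊x / (1 - γ)⌋₊ (γ * x - 1)
    have hcover : (univ : Set (ℕ → Fin 2 × ℝ)) ⊆ {ω | x ≤ numPlays k ⌊x / (1 - γ)⌋₊ ω} ∪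
        {ω | γ * x - 1 ≤ numPlays j ⌊x / (1 - γ)⌋₊ ω} := by
      intro ω _
      by_contra hcon
      simp only [mem_union, mem_ofPred_eq, not_or, not_le] at hcon
      have h1 : (numPlays j ⌊x / (1 - γ)⌋₊ ω : ℝ) + numPlays k ⌊x / (1 - γ)⌋₊ ω =
          ⌊x / (1 - γ)⌋₊ := by exact_mod_cast numPlays_add_numPlays hne _ ω
      linarith [le_floor_div_one_sub hγ hx.le]
    have h2 := (measureReal_mono (μ := F.banditLaw π ν') hcover).trans (measureReal_union_le _ _)
    rw [probReal_univ] at h2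
    have h3 : (F.banditLaw π ν').real {ω | γ * x - 1 ≤ numPlays j ⌊x / (1 - γ)⌋₊ ω} ≤
        f x / (γ * x - 1) := by
      rw [le_div_iff₀ hγx, mul_comm]
      exact hmarkov
    simp only [hq]
    linarith
  have hbound : Tendsto (fun x => Real.log (q x) / Real.log x -
      (f x / Real.log x * F.D θ (ν j) + 1 / Real.log x) / q x) atTop
      (𝓝 (-(F.D θ (ν j) / F.D θ (ν k)))) := by
    have h1 : Tendsto (fun x => Real.log (q x) / Real.log x) atTop (𝓝 0) :=
      (hq1.log one_ne_zero).div_atTop Real.tendsto_log_atTop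
    have h2 : Tendsto (fun x : ℝ => 1 / Real.log x) atTop (𝓝 0) :=
      tendsto_const_nhds.div_atTop Real.tendsto_log_atTop
    have h3 := h1.sub (((hflog.mul_const (F.D θ (ν j))).add h2).div hq1 one_ne_zero)
    have h4 : 0 - (1 / F.D θ (ν k) * F.D θ (ν j) + 0) / 1 = -(F.D θ (ν j) / F.D θ (ν k)) := by
      ring
    rw [h4] at h3
    exact h3
  filter_upwards [hbound.eventually_const_lt (sub_lt_self _ hε), hq1.eventually_const_lt one_pos,
    (tendsto_floor_div_one_sub hγ).eventually_ne_atTop 0, eventually_gt_atTop 1]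
    with x hx hqx hT hx1
  have key := log_numPlays_ge π (fun i => F.law (ν' i)) (fun i => F.law (ν i)) j k
    (F.law_absolutelyContinuous _ _) (fun i hi => by rw [hk i hi]) (F.klDiv_law_ne_top _ _)
    ⌊x / (1 - γ)⌋₊ hT x hqx
  refine ⟨key.1, hx.le.trans ?_⟩
  have hlx := Real.log_pos hx1
  rw [le_div_iff₀ hlx]
  refine le_trans (le_of_eq ?_) key.2
  have hD : (InformationTheory.klDiv (F.law (ν' j)) (F.law (ν j))).toReal = F.D θ (ν j) := by
    rw [hj]; rfl
  rw [hD]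
  change _ = Real.log (q x) - (f x * F.D θ (ν j) + 1) / q x
  field_simp

theorem eventually_forall_mem_Icc_of_atTop {γ : ℝ} (hγ : 0 < γ) {p : ℝ → Prop}
    (hp : ∀ᶠ x in atTop, p x) :
    ∀ᶠ T : ℕ in atTop, ∀ x ∈ Icc ((T : ℝ) ^ γ) ((1 - γ) * T), p x := by
  obtain ⟨a, ha⟩ := eventually_atTop.1 hp
  filter_upwards [((tendsto_rpow_atTop hγ).comp tendsto_natCast_atTop_atTop).eventually_ge_atTop a]
    with T hT x hx
  exact ha x (hT.trans hx.1)

/-- For x ≤ (1 - γ) T the horizon ⌊x / (1 - γ)⌋ is at most T and N_k grows with the horizon. As x ≥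
T ^ γ → ∞, a bound valid for large x is uniform over the interval. -/
theorem IsOptimized.eventually_log_numPlays_ge (hπ : F.IsOptimized π) {ν : Fin 2 → F.Θ}
    {j k : Fin 2} (hjk : ν k < ν j) {γ : ℝ} (hγ : γ ∈ Ioo (0 : ℝ) 1) {θ : F.Θ} (hθ : θ < ν k)
    {ε : ℝ} (hε : 0 < ε) :
    ∀ᶠ T : ℕ in atTop, ∀ x ∈ Icc ((T : ℝ) ^ γ) ((1 - γ) * T),
      0 < (F.banditLaw π ν).real {ω | x ≤ numPlays k T ω} ∧
      -(F.D θ (ν j) / F.D θ (ν k)) - ε ≤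
        Real.log ((F.banditLaw π ν).real {ω | x ≤ numPlays k T ω}) / Real.log x := by
  filter_upwards [eventually_forall_mem_Icc_of_atTop hγ.1
    ((hπ.eventually_log_numPlays_floor_ge hjk hγ hθ hε).and (eventually_gt_atTop 1))] with T hT x hx
  obtain ⟨⟨hpos, hle⟩, hx1⟩ := hT x hx
  have hfloor : ⌊x / (1 - γ)⌋₊ ≤ T := by
    refine Nat.floor_le_of_le ?_
    rw [div_le_iff₀ (sub_pos.2 hγ.2), mul_comm]
    exact hx.2
  have hmono : (F.banditLaw π ν).real {ω | x ≤ numPlays k ⌊x / (1 - γ)⌋₊ ω} ≤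
      (F.banditLaw π ν).real {ω | x ≤ numPlays k T ω} :=
    by
    refine measureReal_mono fun ω hω => ?_
    rw [mem_ofPred_eq] at hω ⊢
    exact hω.trans (Nat.cast_le.2 (numPlays_mono k ω hfloor))
  have hlx := Real.log_pos hx1
  refine ⟨hpos.trans_le hmono, hle.trans ?_⟩
  gcongr

/-- Markov's inequality: the mean of N_k is at most C log T, whose logarithm is negligible against
log x ≥ γ log T. -/
theorem IsOptimized.eventually_log_numPlays_le (hπ : F.IsOptimized π) {ν : Fin 2 → F.Θ}
    {j k : Fin 2} (hjk : ν k < ν j) {γ : ℝ} (hγ : 0 < γ) {ε : ℝ} (hε : 0 < ε) :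
    ∀ᶠ T : ℕ in atTop, ∀ x ∈ Icc ((T : ℝ) ^ γ) ((1 - γ) * T),
      0 < (F.banditLaw π ν).real {ω | x ≤ numPlays k T ω} →
      Real.log ((F.banditLaw π ν).real {ω | x ≤ numPlays k T ω}) / Real.log x ≤ -1 + ε := by
  set C : ℝ := 1 / F.D (ν k) (ν j) + 1 with hC
  have hCpos : 0 < C := by
    have := F.D_nonneg (ν k) (ν j)
    positivity
  have hlogT : Tendsto (fun T : ℕ => Real.log T) atTop atTop :=
    Real.tendsto_log_atTop.comp tendsto_natCast_atTop_atTop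
  have hsmall : ∀ᶠ T : ℕ in atTop, Real.log (C * Real.log T) ≤ ε * (γ * Real.log T) := by
    have hc : 0 < ε * γ / C := by positivity
    have h1 := Real.isLittleO_log_id_atTop.bound hc
    filter_upwards [(hlogT.const_mul_atTop hCpos).eventually h1, hlogT.eventually_gt_atTop 0]
      with T hT hT0
    refine (le_abs_self _).trans (hT.trans_eq ?_)
    rw [id, Real.norm_of_nonneg (by positivity)]
    field_simp
  filter_upwards [hsmall, (hπ ν j k hjk).eventually_lt_const (lt_add_one _),
    eventually_gt_atTop 1] with T hT hE hT1 x hx hpos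
  have hT1' : (1 : ℝ) < T := by exact_mod_cast hT1
  have hlT := Real.log_pos hT1'
  rw [div_lt_iff₀ hlT] at hE
  have hTγ : 0 < (T : ℝ) ^ γ := by positivity
  have hx0 : 0 < x := hTγ.trans_le hx.1
  have hlx : γ * Real.log T ≤ Real.log x := by
    rw [← Real.log_rpow (by linarith)]
    exact Real.log_le_log hTγ hx.1
  have hlx0 : 0 < Real.log x := (mul_pos hγ hlT).trans_le hlx
  have h1 := (F.mul_measureReal_le_integral_numPlays π ν k T x).trans hE.le
  have h2 := Real.log_le_log (mul_pos hx0 hpos) h1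
  rw [Real.log_mul hx0.ne' hpos.ne'] at h2
  rw [div_le_iff₀ hlx0]
  have h3 : ε * (γ * Real.log T) ≤ ε * Real.log x := mul_le_mul_of_nonneg_left hlx hε.le
  linarith

end ExpFamily
end

theorem theorem1 (F : ExpFamily) (π : BanditAlgorithm) (hπ : F.IsOptimized π)
    (ν : Fin 2 → F.Θ) (j k : Fin 2) (hjk : ν k < ν j) (γ : ℝ) (hγ : γ ∈ Set.Ioo (0 : ℝ) 1) :
    (-(⨅ (θ : F.Θ) (_ : θ < ν k), ((F.D θ (ν j) / F.D θ (ν k) : ℝ) : EReal)) ≤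
      liminf (fun T : ℕ => ⨅ x ∈ Set.Icc ((T : ℝ) ^ γ) ((1 - γ) * T),
        ENNReal.log (F.banditLaw π ν {ω | x ≤ numPlays k T ω}) / ((Real.log x : ℝ) : EReal))
        atTop) ∧
    (F.LeftTailCondition →
      ∀ ε : ℝ, 0 < ε → ∀ᶠ T : ℕ in atTop, ∀ x ∈ Set.Icc ((T : ℝ) ^ γ) ((1 - γ) * T),
        0 < (F.banditLaw π ν).real {ω | x ≤ numPlays k T ω} ∧
        |Real.log ((F.banditLaw π ν).real {ω | x ≤ numPlays k T ω}) / Real.log x - (-1)| < ε) := by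
  constructor
  · rw [EReal.neg_le]
    refine le_iInf₂ fun θ hθ => ?_
    rw [EReal.neg_le, ← EReal.coe_neg]
    refine EReal.ge_of_forall_gt_iff_ge.1 fun z hz => ?_
    have hε := sub_pos.2 (EReal.coe_lt_coe_iff.1 hz)
    refine le_liminf_of_le (by isBoundedDefault) ?_
    filter_upwards [hπ.eventually_log_numPlays_ge hjk hγ hθ hε] with T hT
    refine le_iInf₂ fun x hx => ?_
    obtain ⟨hpos, hle⟩ := hT x hx
    rw [← ofReal_measureReal, ENNReal.log_ofReal_of_pos hpos, ← EReal.coe_div, EReal.coe_le_coe_iff]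
    linarith
  · intro hF ε hε
    -- The lower bound loses ε / 4 in the ratio and ε / 4 in the limit; the upper bound loses ε / 2.
    -- Both stay strictly within ε.
    obtain ⟨θ, hθ, hle⟩ := F.exists_D_div_D_le hF hjk (half_pos (half_pos hε))
    filter_upwards [hπ.eventually_log_numPlays_ge hjk hγ hθ (half_pos (half_pos hε)),
      hπ.eventually_log_numPlays_le hjk hγ.1 (half_pos hε)] with T hT hT' x hx
    obtain ⟨hpos, hlow⟩ := hT x hx
    have hup := hT' x hx hpos
    refine ⟨hpos, abs_lt.2 ⟨?_, ?_⟩⟩ <;> linarith
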